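/- Let $p \geq 5$ be a prime number and let $c_{A,B} \in \mathbb{F}_p[A,B]$ be the coefficient of $x^{p-1}$ in \[ \left(x^3 + Ax + B\right)^{\frac{p-1}{2}} \in \mathbb{F}_p[A,B][x]. \] Then $c_{A,B}$ is weighted homogeneous of degree $(p-1)/2$, where $A$ has weight $2$ and $B$ has weight $3$; it is nonzero; and it is absolutely squarefree, i.e. squarefree in $\overline{\mathbb{F}}_p[A,B]$, where $\overline{\mathbb{F}}_p$ is an algebraic closure of $\mathbb{F}_p$. Consequently, for every $\gamma \in \overline{\mathbb{F}}_p \setminus \{0\}$, the polynomial $c_{A,B} - \gamma \in \overline{\mathbb{F}}_p[A,B]$ is irreducible. -/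

import Mathlib

/-- The cubic `x³ + A x + B` as a polynomial in `x` over `𝔽_p[A, B]`, where `A` and `B` are the
variables of index `0` and `1`. -/
noncomputable def weierstrassCubic (p : ℕ) : Polynomial (MvPolynomial (Fin 2) (ZMod p)) :=
  Polynomial.X ^ 3 + Polynomial.C (MvPolynomial.X 0) * Polynomial.X
    + Polynomial.C (MvPolynomial.X 1)

/-- `c_{A,B} ∈ 𝔽_p[A, B]`: the coefficient of `x^(p-1)` in `(x³ + A x + B)^((p-1)/2)`. -/
noncomputable def cAB (p : ℕ) : MvPolynomial (Fin 2) (ZMod p) :=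
  ((weierstrassCubic p) ^ ((p - 1) / 2)).coeff (p - 1)

/-- A polynomial over a field `k` is absolutely squarefree if it is squarefree as a polynomial
over the algebraic closure of `k`. -/
def AbsolutelySquarefree {σ k : Type*} [Field k] (f : MvPolynomial σ k) : Prop :=
  Squarefree (MvPolynomial.map (algebraMap k (AlgebraicClosure k)) f)

/-!
In characteristic `p = 2n + 1`, the coefficient `c` of `x^(2n)` in `(x³ + A x + B)^n` satisfies the
Picard–Fuchs equation `4 D²c = 3 A c`, where `D = 9 B ∂/∂A - 2 A² ∂/∂B` kills
`Δ = 4 A³ + 27 B²`; for the Euler derivation `E = 2 A ∂/∂A + 3 B ∂/∂B` we have `E c = n c`. If `h`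
is an irreducible factor of `c` of multiplicity at least two, comparing powers of `h` in these
equations gives `h ∣ D h` and `h ∣ E h`, hence `h ∣ Δ ∂h/∂A` and `h ∣ Δ ∂h/∂B`. But `h ∤ Δ`, since
every nonzero zero of `Δ` is a rescaling of the nodal cubic `(x - 1)² (x + 2)`, where
`c = 3 ^ n ≠ 0`. So `h` divides both of its partial derivatives, which is impossible as
`0 < deg h < p`.

For `γ ≠ 0`, scaling the variables by powers of `t` according to their weights turns `c - γ` into
`t ^ n c - γ`, and the reverse of this polynomial in `t` is Eisenstein at any prime factor of the
squarefree polynomial `c`.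
-/

open MvPolynomial
open scoped Polynomial

section WeightedHomogeneous

variable {σ R : Type*} [CommSemiring R]

theorem isWeightedHomogeneous_coeff_optionEquivLeft {M : Type*} [AddCancelCommMonoid M]
    {w : Option σ → M} {f : MvPolynomial (Option σ) R} {i : ℕ} {n : M}
    (hf : IsWeightedHomogeneous w f (i • w none + n)) :
    IsWeightedHomogeneous (w ∘ some) ((optionEquivLeft R σ f).coeff i) n := by
  intro d hd
  rw [optionEquivLeft_coeff_coeff] at hd
  have hweight := hf hd
  rw [Finsupp.weight_apply, Finsupp.sum_option_index _ _ (by simp) (by simp [add_smul]),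
    Finsupp.optionElim_apply_none, Finsupp.some_optionElim] at hweight
  exact add_left_cancel hweight

theorem aeval_pow_mul_of_isWeightedHomogeneous {S : Type*} [CommSemiring S] [Algebra R S]
    {w : σ → ℕ} {f : MvPolynomial σ R} {n : ℕ} (hf : IsWeightedHomogeneous w f n) (t : S)
    (x : σ → S) : aeval (fun i => t ^ w i * x i) f = t ^ n * aeval x f := by
  simp only [aeval_def, eval₂_eq, Finset.mul_sum]
  refine Finset.sum_congr rfl fun d hd => ?_
  have hweight : ∑ i ∈ d.support, w i * d i = n := by
    rw [← hf (mem_support_iff.mp hd), Finsupp.weight_apply, Finsupp.sum]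
    exact Finset.sum_congr rfl fun i _ => mul_comm _ _
  simp only [mul_pow, Finset.prod_mul_distrib, ← pow_mul, Finset.prod_pow_eq_pow_sum, hweight]
  ring

/-- The scaling `X i ↦ t ^ w i * X i` attached to a weight `w`, with the parameter `t` as the
variable of a polynomial ring over `MvPolynomial σ R`. -/
noncomputable def weightScaling (R : Type*) [CommSemiring R] (w : σ → ℕ) :
    MvPolynomial σ R →ₐ[R] (MvPolynomial σ R)[X] :=
  aeval fun i => Polynomial.X ^ w i * Polynomial.C (X i)

theorem eval_one_weightScaling (w : σ → ℕ) (f : MvPolynomial σ R) :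
    (weightScaling R w f).eval 1 = f := by
  induction f using MvPolynomial.induction_on with
  | C r => simp [weightScaling, Polynomial.algebraMap_apply, algebraMap_eq]
  | add f g hf hg => rw [map_add, Polynomial.eval_add, hf, hg]
  | mul_X f i hf => rw [map_mul, Polynomial.eval_mul, hf]; simp [weightScaling]

theorem weightScaling_apply_of_isWeightedHomogeneous {w : σ → ℕ} {f : MvPolynomial σ R} {n : ℕ}
    (hf : IsWeightedHomogeneous w f n) :
    weightScaling R w f = Polynomial.C f * Polynomial.X ^ n := by
  have hC : aeval (fun i => Polynomial.C (X i : MvPolynomial σ R)) f = Polynomial.C f :=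
    (DFunLike.congr_fun (aeval_unique (Polynomial.CAlgHom (R := R))) f).symm
  rw [weightScaling, aeval_pow_mul_of_isWeightedHomogeneous hf, hC, mul_comm]

theorem totalDegree_le_of_isWeightedHomogeneous {w : σ → ℕ} (hw : ∀ i, w i ≠ 0)
    {f : MvPolynomial σ R} {n : ℕ} (hf : IsWeightedHomogeneous w f n) : f.totalDegree ≤ n := by
  refine Finset.sup_le fun d hd => ?_
  rw [← hf (mem_support_iff.mp hd), Finsupp.weight_apply]
  exact Finset.sum_le_sum fun i _ => Nat.le_mul_of_pos_right _ (Nat.pos_of_ne_zero (hw i))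

end WeightedHomogeneous

section Irreducibility

theorem irreducible_of_irreducible_reverse {R : Type*} [CommRing R] [NoZeroDivisors R] {f : R[X]}
    (hf0 : f.coeff 0 ≠ 0) (hf : Irreducible f.reverse) : Irreducible f := by
  have isUnit_of_dvd : ∀ g, g ∣ f → IsUnit g.reverse → IsUnit g := by
    rintro g ⟨g', rfl⟩ hg
    rw [Polynomial.mul_coeff_zero] at hf0
    have hdeg : g.natDegree = 0 := by
      rw [Polynomial.natDegree_eq_reverse_natDegree_add_natTrailingDegree,
        Polynomial.natDegree_eq_zero_of_isUnit hg,
        Polynomial.natTrailingDegree_eq_zero.mpr (Or.inr (left_ne_zero_of_mul hf0))]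
    rw [Polynomial.eq_C_of_natDegree_eq_zero hdeg] at hg ⊢
    rwa [Polynomial.reverse_C] at hg
  refine ⟨fun hunit => hf.not_isUnit ?_, fun g g' hgg' => ?_⟩
  · obtain ⟨r, hr, rfl⟩ := Polynomial.isUnit_iff.mp hunit
    simpa only [Polynomial.reverse_C] using hr.map Polynomial.C
  · rw [hgg', Polynomial.reverse_mul_of_domain] at hf
    exact (hf.isUnit_or_isUnit rfl).imp (isUnit_of_dvd g (hgg' ▸ dvd_mul_right g g'))
      (isUnit_of_dvd g' (hgg' ▸ dvd_mul_left g' g))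

theorem irreducible_C_mul_X_pow_add_C {R : Type*} [CommRing R] [IsDomain R] {a q u : R}
    (hq : Prime q) (hqa : q ∣ a) (hqqa : ¬ q * q ∣ a) (hu : IsUnit u) {n : ℕ} (hn : n ≠ 0) :
    Irreducible (Polynomial.C u * Polynomial.X ^ n + Polynomial.C a) := by
  set f := Polynomial.C u * Polynomial.X ^ n + Polynomial.C a with hf
  have hdeg : f.natDegree = n := by
    rw [hf, Polynomial.natDegree_add_C, Polynomial.natDegree_C_mul_X_pow n u hu.ne_zero]
  have hcoeff_n : f.coeff n = u := by simp [hf, Polynomial.coeff_C, hn]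
  have hcoeff_zero : f.coeff 0 = a := by simp [hf, hn.symm]
  have hprime : (Ideal.span {q}).IsPrime := (Ideal.span_singleton_prime hq.ne_zero).mpr hq
  have hprimitive : f.IsPrimitive := fun r hr =>
    isUnit_of_dvd_unit (hcoeff_n ▸ (Polynomial.C_dvd_iff_dvd_coeff r f).mp hr n) hu
  refine Polynomial.IsEisensteinAt.irreducible ⟨?_, fun {k} hk => ?_, ?_⟩ hprime hprimitive
    (hdeg ▸ Nat.pos_of_ne_zero hn)
  · rw [Polynomial.leadingCoeff, hdeg, hcoeff_n, Ideal.mem_span_singleton]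
    exact fun hqu => hq.not_isUnit (isUnit_of_dvd_unit hqu hu)
  · rw [hdeg] at hk
    rw [Ideal.mem_span_singleton]
    rcases eq_or_ne k 0 with rfl | hk0
    · rwa [hcoeff_zero]
    · simp [hf, Polynomial.coeff_C, hk0, hk.ne]
  · rwa [hcoeff_zero, Ideal.span_singleton_pow, Ideal.mem_span_singleton, sq]

variable {σ R : Type*} [CommRing R] {w : σ → ℕ} {f : MvPolynomial σ R} {n : ℕ}

theorem not_isUnit_of_isWeightedHomogeneous [Nontrivial R] [IsReduced R]
    (hf : IsWeightedHomogeneous w f n) (hn : n ≠ 0) : ¬ IsUnit f := by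
  intro hunit
  obtain ⟨r, -, rfl⟩ := isUnit_iff_eq_C_of_isReduced.mp hunit
  exact hn (hf.inj_right hunit.ne_zero (isWeightedHomogeneous_C w r))

theorem irreducible_sub_C_of_isWeightedHomogeneous [IsDomain R] [UniqueFactorizationMonoid R]
    (hf : IsWeightedHomogeneous w f n) (hn : n ≠ 0) (hsq : Squarefree f) {γ : R}
    (hγ : IsUnit γ) : Irreducible (f - C γ) := by
  obtain ⟨q, hq, hqf⟩ :=
    WfDvdMonoid.exists_irreducible_factor (not_isUnit_of_isWeightedHomogeneous hf hn) hsq.ne_zero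
  have hunit : IsUnit (C (-γ) : MvPolynomial σ R) := hγ.neg.map C
  have hscaled : weightScaling R w (f - C γ) =
      Polynomial.C f * Polynomial.X ^ n + Polynomial.C (C (-γ)) := by
    rw [map_sub, weightScaling_apply_of_isWeightedHomogeneous hf,
      weightScaling_apply_of_isWeightedHomogeneous (isWeightedHomogeneous_C w γ), pow_zero,
      mul_one, map_neg, map_neg, sub_eq_add_neg]
  have hreverse : (weightScaling R w (f - C γ)).reverse =
      Polynomial.C (C (-γ)) * Polynomial.X ^ n + Polynomial.C f := by
    rw [hscaled, Polynomial.reverse_add_C, Polynomial.reverse_mul_X_pow, Polynomial.reverse_C,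
      Polynomial.natDegree_C_mul_X_pow n f hsq.ne_zero, add_comm]
  have hlocal : IsLocalHom (weightScaling R w) :=
    isLocalHom_of_leftInverse (Polynomial.evalRingHom 1) (eval_one_weightScaling w)
  refine Irreducible.of_map (f := weightScaling R w) (irreducible_of_irreducible_reverse ?_ ?_)
  · simpa [hscaled, hn.symm] using hunit.ne_zero
  · rw [hreverse]
    exact irreducible_C_mul_X_pow_add_C hq.prime hqf (fun hqq => hq.not_isUnit (hsq q hqq)) hunit
      hn

end Irreducibility

section Derivation

variable {R A : Type*} [CommSemiring R]

section

variable [CommSemiring A] [Algebra R A] (δ : Derivation R A A)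

theorem derivation_ofNat (n : ℕ) [n.AtLeastTwo] : δ (ofNat(n) : A) = 0 := δ.map_natCast n

theorem derivation_pow_succ_mul (h u : A) (m : ℕ) :
    δ (h ^ (m + 1) * u) = h ^ m * ((m + 1 : ℕ) * (u * δ h) + h * δ u) := by
  rw [Derivation.leibniz, Derivation.leibniz_pow, Nat.add_sub_cancel]
  simp only [smul_eq_mul, nsmul_eq_mul]
  ring

theorem derivation_derivation_pow_add_two (f : A) (k : ℕ) :
    δ (δ (f ^ (k + 2))) = (k + 2) * f ^ k * ((k + 1) * δ f ^ 2 + f * δ (δ f)) := by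
  have hδ : δ (f ^ (k + 2)) = (k + 2 : ℕ) • (f ^ (k + 1) * δ f) := by
    rw [Derivation.leibniz_pow, smul_eq_mul, Nat.add_succ_sub_one]
  rw [hδ, map_nsmul, derivation_pow_succ_mul, nsmul_eq_mul]
  push_cast
  ring

end

variable [CommRing A] [IsDomain A] [Algebra R A] {δ : Derivation R A A} {h u : A} {m : ℕ}

theorem dvd_derivation_of_pow_dvd_derivation (hh : Prime h) (hu : ¬ h ∣ u)
    (hm : ¬ h ∣ ((m + 1 : ℕ) : A)) (hdvd : h ^ (m + 1) ∣ δ (h ^ (m + 1) * u)) : h ∣ δ h := by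
  rw [derivation_pow_succ_mul, pow_succ, mul_dvd_mul_iff_left (pow_ne_zero m hh.ne_zero),
    dvd_add_left (dvd_mul_right _ _)] at hdvd
  exact ((hh.dvd_mul.mp hdvd).resolve_left hm |> hh.dvd_mul.mp).resolve_left hu

theorem dvd_derivation_of_pow_dvd_derivation_derivation (hh : Prime h) (hu : ¬ h ∣ u)
    (hm₁ : ¬ h ∣ ((m + 1 : ℕ) : A)) (hm₂ : ¬ h ∣ ((m + 2 : ℕ) : A))
    (hdvd : h ^ (m + 2) ∣ δ (δ (h ^ (m + 2) * u))) : h ∣ δ h := by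
  rw [derivation_pow_succ_mul δ h u (m + 1)] at hdvd
  by_cases hv : h ∣ (m + 2 : ℕ) * (u * δ h) + h * δ u
  · rw [dvd_add_left (dvd_mul_right _ _)] at hv
    exact ((hh.dvd_mul.mp hv).resolve_left hm₂ |> hh.dvd_mul.mp).resolve_left hu
  · exact dvd_derivation_of_pow_dvd_derivation hh hv hm₁
      ((pow_dvd_pow h (Nat.le_succ _)).trans hdvd)

end Derivation

section PartialDerivative

variable {σ R : Type*} [CommSemiring R] {f : MvPolynomial σ R} {i : σ}

theorem totalDegree_pderiv_lt (hf : pderiv i f ≠ 0) :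
    (pderiv i f).totalDegree < f.totalDegree := by
  have hlt : ∀ d ∈ (pderiv i f).support, d.degree < f.totalDegree := by
    intro d hd
    rw [mem_support_iff, coeff_pderiv] at hd
    have hle := le_totalDegree (mem_support_iff.mpr (left_ne_zero_of_mul hd))
    change (d + Finsupp.single i 1).degree ≤ _ at hle
    rw [map_add, Finsupp.degree_single] at hle
    omega
  obtain ⟨d, hd⟩ := support_nonempty.mpr hf
  exact (Finset.sup_lt_iff ((Nat.zero_le _).trans_lt (hlt d hd))).mpr hlt

variable [NoZeroDivisors R]

theorem pderiv_eq_zero_of_dvd_pderiv (hf : f ∣ pderiv i f) : pderiv i f = 0 := by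
  by_contra h0
  exact (totalDegree_le_of_dvd_of_isDomain hf h0).not_gt (totalDegree_pderiv_lt h0)

theorem exists_not_dvd_pderiv (p : ℕ) [CharP R p] (hpos : 0 < f.totalDegree)
    (hlt : f.totalDegree < p) : ∃ i, ¬ f ∣ pderiv i f := by
  obtain ⟨d, hd, i, hi⟩ : ∃ d ∈ f.support, ∃ i, d i ≠ 0 := by
    contrapose! hpos
    exact ((MvPolynomial.totalDegree_eq_zero_iff _ f).mpr hpos).le
  have hdi : (d i : R) ≠ 0 := by
    rw [Ne, CharP.cast_eq_zero_iff R p]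
    exact Nat.not_dvd_of_pos_of_lt (Nat.pos_of_ne_zero hi)
      (((Finsupp.le_degree i d).trans (le_totalDegree hd)).trans_lt hlt)
  have hcoeff : coeff (d - Finsupp.single i 1) (pderiv i f) = coeff d f * d i := by
    have hle : Finsupp.single i 1 ≤ d := Finsupp.single_le_iff.mpr (Nat.one_le_iff_ne_zero.mpr hi)
    rw [coeff_pderiv, tsub_add_cancel_of_le hle, ← Nat.cast_succ, Finsupp.tsub_apply,
      Finsupp.single_eq_same, Nat.succ_eq_add_one,
      Nat.sub_add_cancel (Nat.one_le_iff_ne_zero.mpr hi)]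
  refine ⟨i, fun hdvd => mul_ne_zero (mem_support_iff.mp hd) hdi ?_⟩
  rw [← hcoeff, pderiv_eq_zero_of_dvd_pderiv hdvd, coeff_zero]

end PartialDerivative

section HasseCoeff

/-- The cubic `x³ + A x + B` in `x` over `R[A, B]`, where `A` and `B` are the variables of index
`0` and `1`: the analogue of `weierstrassCubic` over an arbitrary coefficient ring. -/
noncomputable def genericCubic (R : Type*) [CommSemiring R] : (MvPolynomial (Fin 2) R)[X] :=
  Polynomial.X ^ 3 + Polynomial.C (X 0) * Polynomial.X + Polynomial.C (X 1)

/-- The coefficient of `x^(2n)` in `(x³ + A x + B)^n`. In characteristic `p = 2n + 1` it is the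
Hasse invariant of the curve `y² = x³ + A x + B`. -/
noncomputable def hasseCoeff (R : Type*) [CommSemiring R] (n : ℕ) : MvPolynomial (Fin 2) R :=
  (genericCubic R ^ n).coeff (2 * n)

theorem cAB_two_mul_add_one (n : ℕ) : cAB (2 * n + 1) = hasseCoeff (ZMod (2 * n + 1)) n := by
  rw [cAB, Nat.add_sub_cancel, Nat.mul_div_cancel_left n two_pos]
  rfl

theorem map_hasseCoeff {R S : Type*} [CommSemiring R] [CommSemiring S] (φ : R →+* S) (n : ℕ) :
    map φ (hasseCoeff R n) = hasseCoeff S n := by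
  rw [hasseCoeff, hasseCoeff, ← Polynomial.coeff_map, Polynomial.map_pow]
  simp [genericCubic]

theorem aeval_hasseCoeff {R S : Type*} [CommSemiring R] [CommSemiring S] [Algebra R S] (n : ℕ)
    (v : Fin 2 → S) : aeval v (hasseCoeff R n) =
      ((Polynomial.X ^ 3 + Polynomial.C (v 0) * Polynomial.X + Polynomial.C (v 1)) ^ n).coeff
        (2 * n) := by
  rw [hasseCoeff, ← RingHom.coe_coe (aeval v), ← Polynomial.coeff_map, Polynomial.map_pow]
  simp [genericCubic]

theorem isWeightedHomogeneous_hasseCoeff (R : Type*) [CommSemiring R] (n : ℕ) :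
    IsWeightedHomogeneous (![2, 3] : Fin 2 → ℕ) (hasseCoeff R n) n := by
  let w : Option (Fin 2) → ℕ := fun i => i.elim 1 ![2, 3]
  let F : MvPolynomial (Option (Fin 2)) R := X none ^ 3 + X (some 0) * X none + X (some 1)
  have hF : optionEquivLeft R (Fin 2) F = genericCubic R := by simp [F, genericCubic]
  have hx : IsWeightedHomogeneous w (X none : MvPolynomial _ R) 1 := isWeightedHomogeneous_X R w _
  have hA : IsWeightedHomogeneous w (X (some 0) : MvPolynomial _ R) 2 :=
    isWeightedHomogeneous_X R w _
  have hB : IsWeightedHomogeneous w (X (some 1) : MvPolynomial _ R) 3 :=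
    isWeightedHomogeneous_X R w _
  have hpow : IsWeightedHomogeneous w (F ^ n) ((2 * n) • w none + n) := by
    convert (((hx.pow 3).add (hA.mul hx)).add hB).pow n using 1
    simp only [w, Option.elim_none, smul_eq_mul]
    ring
  rw [hasseCoeff, ← hF, ← map_pow]
  exact isWeightedHomogeneous_coeff_optionEquivLeft hpow

end HasseCoeff

section PicardFuchs

/-- The derivation of `A[X]` that applies a derivation of `A` to each coefficient. -/
noncomputable def coeffwiseDerivation {R A : Type*} [CommRing R] [CommRing A] [Algebra R A]
    (δ : Derivation R A A) : Derivation R A[X] A[X] :=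
  PolynomialModule.equivPolynomialSelf.toLinearMap.compDer δ.mapCoeffs

section

variable {R A : Type*} [CommRing R] [CommRing A] [Algebra R A] (δ : Derivation R A A)

theorem coeff_coeffwiseDerivation (f : A[X]) (i : ℕ) :
    (coeffwiseDerivation δ f).coeff i = δ (f.coeff i) := rfl

theorem coeffwiseDerivation_X : coeffwiseDerivation δ (Polynomial.X : A[X]) = 0 := by
  ext i
  rw [coeff_coeffwiseDerivation, Polynomial.coeff_X, apply_ite δ, Derivation.map_one_eq_zero,
    map_zero, ite_self, Polynomial.coeff_zero]

theorem coeffwiseDerivation_C (a : A) :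
    coeffwiseDerivation δ (Polynomial.C a) = Polynomial.C (δ a) := by
  ext i
  rw [coeff_coeffwiseDerivation, Polynomial.coeff_C, Polynomial.coeff_C, apply_ite δ, map_zero]

end

/- Griffiths' pole-order reduction: `Q` was found by undetermined coefficients so that, for
`F = x³ + a x + b` and `2k + 5 = 0`, `3 (D F)² - 2 F D²F - 3 a F² = 2 F δQ - 3 Q δF`. -/
theorem four_mul_derivation_derivation_cubic_pow {R S P : Type*} [CommSemiring R]
    [CommSemiring S] [CommRing P] [Algebra R P] [Algebra S P] (D : Derivation R P P)
    (δ : Derivation S P P) {a b x : P} (hDa : D a = 9 * b) (hDb : D b = -2 * a ^ 2)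
    (hDx : D x = 0) (hδa : δ a = 0) (hδb : δ b = 0) (hδx : δ x = 1) {k : ℕ}
    (hk : (2 * k + 5 : P) = 0) :
    4 * D (D ((x ^ 3 + a * x + b) ^ (k + 2))) = 3 * a * (x ^ 3 + a * x + b) ^ (k + 2) +
      2 * δ ((x ^ 3 + a * x + b) ^ (k + 1) *
        (3 * a * x ^ 4 - 3 * a ^ 2 * x ^ 2 - 6 * a * b * x - 4 * a ^ 3 - 27 * b ^ 2)) := by
  set F := x ^ 3 + a * x + b with hF
  set Q := 3 * a * x ^ 4 - 3 * a ^ 2 * x ^ 2 - 6 * a * b * x - 4 * a ^ 3 - 27 * b ^ 2 with hQ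
  have hDF : D F = 9 * b * x - 2 * a ^ 2 := by
    simp only [hF, map_add, Derivation.leibniz, Derivation.leibniz_pow, hDa, hDb, hDx,
      smul_eq_mul, nsmul_eq_mul]
    ring
  have hDDF : D (D F) = -18 * a ^ 2 * x - 36 * a * b := by
    simp only [hDF, map_sub, Derivation.leibniz, Derivation.leibniz_pow, hDa, hDb, hDx,
      derivation_ofNat, smul_eq_mul, nsmul_eq_mul]
    push_cast
    ring
  have hδF : δ F = 3 * x ^ 2 + a := by
    simp only [hF, map_add, Derivation.leibniz, Derivation.leibniz_pow, hδa, hδb, hδx,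
      smul_eq_mul, nsmul_eq_mul]
    push_cast
    ring
  have hδQ : δ Q = 12 * a * x ^ 3 - 6 * a ^ 2 * x - 6 * a * b := by
    simp only [hQ, map_sub, Derivation.leibniz, Derivation.leibniz_pow, hδa, hδb, hδx,
      derivation_ofNat, smul_eq_mul, nsmul_eq_mul]
    push_cast
    ring
  have hpole : 3 * D F ^ 2 - 2 * F * D (D F) - 3 * a * F ^ 2 = 2 * F * δ Q - 3 * Q * δ F := by
    rw [hDDF, hDF, hδF, hδQ, hF, hQ]
    ring
  rw [derivation_derivation_pow_add_two, derivation_pow_succ_mul]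
  push_cast
  linear_combination F ^ k * hpole
    + F ^ k * ((2 * k + 1) * D F ^ 2 + 2 * F * D (D F) - Q * δ F) * hk

/-- The derivation `9 B ∂/∂A - 2 A² ∂/∂B` of `R[A, B]`, which kills `4 A³ + 27 B²`. Under the
substitution `A = -27 E₄`, `B = -54 E₆` it is `-54` times the Ramanujan–Serre derivation. -/
noncomputable def serreDerivation (R : Type*) [CommRing R] :
    Derivation R (MvPolynomial (Fin 2) R) (MvPolynomial (Fin 2) R) :=
  (9 * X 1 : MvPolynomial (Fin 2) R) • pderiv 0 - (2 * X 0 ^ 2 : MvPolynomial (Fin 2) R) • pderiv 1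

theorem serreDerivation_apply {R : Type*} [CommRing R] (f : MvPolynomial (Fin 2) R) :
    serreDerivation R f = 9 * X 1 * pderiv 0 f - 2 * X 0 ^ 2 * pderiv 1 f := rfl

theorem serreDerivation_X_zero (R : Type*) [CommRing R] :
    serreDerivation R (X 0) = 9 * X 1 := by
  simp [serreDerivation_apply, pderiv_X]

theorem serreDerivation_X_one (R : Type*) [CommRing R] :
    serreDerivation R (X 1) = -2 * X 0 ^ 2 := by
  simp [serreDerivation_apply, pderiv_X]

theorem four_mul_serreDerivation_serreDerivation_hasseCoeff {R : Type*} [CommRing R] {n : ℕ}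
    (hn : 2 ≤ n) (hchar : ((2 * n + 1 : ℕ) : R) = 0) :
    4 * serreDerivation R (serreDerivation R (hasseCoeff R n)) = 3 * X 0 * hasseCoeff R n := by
  obtain ⟨k, rfl⟩ := Nat.exists_eq_add_of_le' hn
  have hchar' : ((2 * (k + 2) + 1 : ℕ) : MvPolynomial (Fin 2) R) = 0 := by
    rw [← map_natCast C, hchar, map_zero]
  have hk : (2 * k + 5 : (MvPolynomial (Fin 2) R)[X]) = 0 := by
    rw [← Polynomial.C_0, ← hchar', map_natCast]
    push_cast
    ring
  have hODE := congrArg (fun f => Polynomial.coeff f (2 * (k + 2)))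
    (four_mul_derivation_derivation_cubic_pow (coeffwiseDerivation (serreDerivation R))
      Polynomial.derivative' (a := Polynomial.C (X 0)) (b := Polynomial.C (X 1)) (x := Polynomial.X)
      (by simp [coeffwiseDerivation_C, serreDerivation_X_zero, Polynomial.C_ofNat])
      (by simp [coeffwiseDerivation_C, serreDerivation_X_one, Polynomial.C_ofNat])
      (coeffwiseDerivation_X _) (by simp) (by simp) (by simp) hk)
  simp only [Polynomial.derivative'_apply, Polynomial.coeff_add, Polynomial.coeff_ofNat_mul,
    mul_assoc, Polynomial.coeff_C_mul, Polynomial.coeff_derivative, coeff_coeffwiseDerivation,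
    ← Nat.cast_succ, Nat.succ_eq_add_one, hchar', mul_zero, add_zero] at hODE
  rwa [mul_assoc]

end PicardFuchs

section Discriminant

/-- The Euler derivation `2 A ∂/∂A + 3 B ∂/∂B` of `R[A, B]` for the weights `2` and `3`. -/
noncomputable def eulerDerivation (R : Type*) [CommSemiring R] :
    Derivation R (MvPolynomial (Fin 2) R) (MvPolynomial (Fin 2) R) :=
  (2 * X 0 : MvPolynomial (Fin 2) R) • pderiv 0 + (3 * X 1 : MvPolynomial (Fin 2) R) • pderiv 1

/-- The polynomial `4 A³ + 27 B²`, the negative of the discriminant of `x³ + A x + B`. -/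
noncomputable def cubicDisc (R : Type*) [CommSemiring R] : MvPolynomial (Fin 2) R :=
  4 * X 0 ^ 3 + 27 * X 1 ^ 2

theorem eulerDerivation_apply {R : Type*} [CommSemiring R] (f : MvPolynomial (Fin 2) R) :
    eulerDerivation R f = 2 * X 0 * pderiv 0 f + 3 * X 1 * pderiv 1 f := rfl

theorem eulerDerivation_of_isWeightedHomogeneous {R : Type*} [CommSemiring R]
    {f : MvPolynomial (Fin 2) R} {n : ℕ} (hf : IsWeightedHomogeneous (![2, 3] : Fin 2 → ℕ) f n) :
    eulerDerivation R f = n • f := by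
  rw [← hf.sum_weight_X_mul_pderiv, Fin.sum_univ_two, eulerDerivation_apply]
  simp only [Matrix.cons_val_zero, Matrix.cons_val_one, nsmul_eq_mul, ← mul_assoc, Nat.cast_ofNat]

variable {R : Type*} [CommRing R]

/- Cramer's rule: `cubicDisc` is a multiple of the determinant of the two derivations. -/
theorem dvd_cubicDisc_mul_pderiv {h : MvPolynomial (Fin 2) R} (hserre : h ∣ serreDerivation R h)
    (heuler : h ∣ eulerDerivation R h) (i : Fin 2) : h ∣ cubicDisc R * pderiv i h := by
  rw [serreDerivation_apply] at hserre
  rw [eulerDerivation_apply] at heuler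
  fin_cases i
  · convert dvd_add (hserre.mul_left (3 * X 1)) (heuler.mul_left (2 * X 0 ^ 2)) using 1
    simp only [cubicDisc, Fin.zero_eta]
    ring
  · convert dvd_sub (heuler.mul_left (9 * X 1)) (hserre.mul_left (2 * X 0)) using 1
    simp only [cubicDisc, Fin.mk_one]
    ring

theorem dvd_cubicDisc_of_dvd_derivations [NoZeroDivisors R] (p : ℕ) [CharP R p]
    {h : MvPolynomial (Fin 2) R} (hh : Prime h) (hserre : h ∣ serreDerivation R h)
    (heuler : h ∣ eulerDerivation R h) (hpos : 0 < h.totalDegree) (hlt : h.totalDegree < p) :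
    h ∣ cubicDisc R := by
  obtain ⟨i, hi⟩ := exists_not_dvd_pderiv p hpos hlt
  exact (hh.dvd_mul.mp (dvd_cubicDisc_mul_pderiv hserre heuler i)).resolve_right hi

end Discriminant

section NodalCubic

theorem coeff_geom_sum_mul {R : Type*} [CommSemiring R] {m : ℕ} {g : R[X]}
    (hg : g.natDegree ≤ m) :
    ((∑ i ∈ Finset.range (m + 1), Polynomial.X ^ i) * g).coeff m = g.eval 1 := by
  rw [Finset.sum_mul, Polynomial.finsetSum_coeff,
    Polynomial.eval_eq_sum_range' (Nat.lt_succ_of_le hg), ← Finset.sum_range_reflect]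
  refine Finset.sum_congr rfl fun i hi => ?_
  have hi' : m + 1 - 1 - i ≤ m := by omega
  rw [Polynomial.coeff_X_pow_mul', if_pos hi', one_pow, mul_one]
  congr 1
  have := Finset.mem_range.mp hi
  omega

theorem X_sub_one_pow_char_sub_one (R : Type*) [CommRing R] (p : ℕ) [Fact p.Prime] [CharP R p] :
    (Polynomial.X - 1 : R[X]) ^ (p - 1) = ∑ i ∈ Finset.range p, Polynomial.X ^ i := by
  rw [← Polynomial.cyclotomic_prime, ← Polynomial.cyclotomic_one,
    ← Polynomial.cyclotomic_mul_prime_eq_pow_of_not_dvd R (Nat.Prime.not_dvd_one Fact.out),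
    one_mul]

variable {R S : Type*} {n : ℕ}

theorem aeval_nodal_hasseCoeff [CommSemiring R] [CommRing S] [Algebra R S]
    [Fact (2 * n + 1).Prime] [CharP S (2 * n + 1)] :
    aeval ![(-3 : S), 2] (hasseCoeff R n) = 3 ^ n := by
  have hnodal : (Polynomial.X ^ 3 + Polynomial.C (-3 : S) * Polynomial.X + Polynomial.C 2) =
      (Polynomial.X - 1) ^ 2 * (Polynomial.X + Polynomial.C 2) := by
    simp only [Polynomial.C_neg, Polynomial.C_ofNat]
    ring
  have hgeom := X_sub_one_pow_char_sub_one S (2 * n + 1)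
  rw [Nat.add_sub_cancel] at hgeom
  have hdeg : ((Polynomial.X + Polynomial.C (2 : S)) ^ n).natDegree ≤ 2 * n := by
    compute_degree
    omega
  rw [aeval_hasseCoeff, Matrix.cons_val_zero, Matrix.cons_val_one, Matrix.cons_val_zero, hnodal,
    mul_pow, ← pow_mul, hgeom, coeff_geom_sum_mul hdeg, Polynomial.eval_pow, Polynomial.eval_add,
    Polynomial.eval_X, Polynomial.eval_C]
  norm_num

end NodalCubic

section Squarefree

theorem isUnit_natCast_of_lt (R : Type*) [Ring R] (p : ℕ) [Fact p.Prime] [CharP R p] {m : ℕ}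
    (hpos : 0 < m) (hlt : m < p) : IsUnit (m : R) :=
  (CharP.isUnit_natCast_iff Fact.out).mpr (Nat.not_dvd_of_pos_of_lt hpos hlt)

theorem not_dvd_natCast_of_lt {R : Type*} [CommRing R] (p : ℕ) [Fact p.Prime] [CharP R p]
    {h : R} (hh : Prime h) {m : ℕ} (hpos : 0 < m) (hlt : m < p) : ¬ h ∣ (m : R) :=
  fun hdvd => hh.not_isUnit (isUnit_of_dvd_unit hdvd (isUnit_natCast_of_lt R p hpos hlt))

theorem exists_eq_pow_add_two_mul_and_not_dvd {M : Type*} [CommMonoidWithZero M]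
    [IsCancelMulZero M] [WfDvdMonoid M] {h c : M} (hh : Prime h) (hc : c ≠ 0) (hdvd : h * h ∣ c) :
    ∃ m u, c = h ^ (m + 2) * u ∧ ¬ h ∣ u := by
  have hfin := FiniteMultiplicity.of_prime_left hh hc
  obtain ⟨u, hcu, hu⟩ := hfin.exists_eq_pow_mul_and_not_dvd
  obtain ⟨m, hm⟩ := Nat.exists_eq_add_of_le' (hfin.le_multiplicity_of_pow_dvd (sq h ▸ hdvd))
  exact ⟨m, u, hm ▸ hcu, hu⟩

theorem mul_totalDegree_le_of_pow_dvd {σ R : Type*} [CommSemiring R] [NoZeroDivisors R]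
    {f g : MvPolynomial σ R} {k : ℕ} (hg : g ≠ 0) (hdvd : f ^ k ∣ g) :
    k * f.totalDegree ≤ g.totalDegree := by
  induction k generalizing g with
  | zero => simp
  | succ k ih =>
    obtain ⟨u, rfl⟩ := hdvd
    rw [pow_succ', mul_assoc] at hg ⊢
    rw [totalDegree_mul_of_isDomain (left_ne_zero_of_mul hg) (right_ne_zero_of_mul hg),
      Nat.succ_mul, add_comm]
    exact Nat.add_le_add_left (ih (right_ne_zero_of_mul hg) (dvd_mul_right _ _)) _

theorem totalDegree_pos_of_prime {σ K : Type*} [Field K] {h : MvPolynomial σ K} (hh : Prime h) :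
    0 < h.totalDegree := by
  refine Nat.pos_of_ne_zero fun hdeg => hh.not_isUnit ?_
  have hC := totalDegree_eq_zero_iff_eq_C.mp hdeg
  have hcoeff : coeff 0 h ≠ 0 := fun h0 => hh.ne_zero (by rw [hC, h0, C_0])
  exact isUnit_iff_totalDegree_of_isReduced.mpr ⟨hcoeff.isUnit, hdeg⟩

variable {n : ℕ} [Fact (2 * n + 1).Prime]

theorem hasseCoeff_ne_zero (R : Type*) [CommRing R] [CharP R (2 * n + 1)] (hn : 2 ≤ n) :
    hasseCoeff R n ≠ 0 := by
  have : Nontrivial R := CharP.nontrivial_of_char_ne_one (v := 2 * n + 1) (by omega)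
  have h3 : IsUnit ((3 : ℕ) : R) := isUnit_natCast_of_lt R (2 * n + 1) (by omega) (by omega)
  intro h0
  have hnodal := aeval_nodal_hasseCoeff (R := R) (S := R) (n := n)
  rw [h0, map_zero] at hnodal
  exact (h3.pow n).ne_zero (by exact_mod_cast hnodal.symm)

/- If `4 a³ + 27 b² = 0`, scaling `(a, b)` by `2 a` and the nodal point `(-3, 2)` by `-3 b` gives
the same point. -/
theorem eq_zero_of_aeval_cubicDisc_of_aeval_hasseCoeff {R S : Type*} [CommSemiring R]
    [CommRing S] [IsDomain S] [Algebra R S] [CharP S (2 * n + 1)] (hn : 2 ≤ n) {x : Fin 2 → S}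
    (hdisc : aeval x (cubicDisc R) = 0) (hc : aeval x (hasseCoeff R n) = 0) : x = 0 := by
  have h3 : (3 : S) ≠ 0 := by
    exact_mod_cast (isUnit_natCast_of_lt S (2 * n + 1) (m := 3) (by omega) (by omega)).ne_zero
  have h4 : (4 : S) ≠ 0 := by
    exact_mod_cast (isUnit_natCast_of_lt S (2 * n + 1) (m := 4) (by omega) (by omega)).ne_zero
  have hx : 4 * x 0 ^ 3 + 27 * x 1 ^ 2 = 0 := by
    simpa only [cubicDisc, map_add, map_mul, map_pow, map_ofNat, aeval_X] using hdisc
  have hscale : (fun i => (2 * x 0) ^ (![2, 3] : Fin 2 → ℕ) i * x i) =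
      fun i => (-3 * x 1) ^ (![2, 3] : Fin 2 → ℕ) i * ![(-3 : S), 2] i := by
    funext i
    fin_cases i
    · change (2 * x 0) ^ 2 * x 0 = (-3 * x 1) ^ 2 * (-3)
      linear_combination hx
    · change (2 * x 0) ^ 3 * x 1 = (-3 * x 1) ^ 3 * 2
      linear_combination 2 * x 1 * hx
  have hvalue : (-3 * x 1) ^ n * 3 ^ n = 0 := by
    have hhom := isWeightedHomogeneous_hasseCoeff R n
    rw [← aeval_nodal_hasseCoeff (R := R) (S := S), ← aeval_pow_mul_of_isWeightedHomogeneous hhom,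
      ← hscale, aeval_pow_mul_of_isWeightedHomogeneous hhom, hc, mul_zero]
  have hx1 : x 1 = 0 := by
    have hpow := (mul_eq_zero.mp hvalue).resolve_right (pow_ne_zero n h3)
    exact (mul_eq_zero.mp (eq_zero_of_pow_eq_zero hpow)).resolve_left (neg_ne_zero.mpr h3)
  have hx0 : x 0 = 0 := by
    rw [hx1, zero_pow two_ne_zero, mul_zero, add_zero] at hx
    exact eq_zero_of_pow_eq_zero ((mul_eq_zero.mp hx).resolve_left h4)
  funext i
  fin_cases i <;> assumption

theorem not_dvd_cubicDisc_of_dvd_hasseCoeff {K : Type*} [Field K] [CharP K (2 * n + 1)]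
    (hn : 2 ≤ n) {h : MvPolynomial (Fin 2) K} (hh : Prime h) (hc : h ∣ hasseCoeff K n) :
    ¬ h ∣ cubicDisc K := by
  intro hdisc
  have hprime : (Ideal.span {h}).IsPrime := (Ideal.span_singleton_prime hh.ne_zero).mpr hh
  let π := Ideal.Quotient.mkₐ K (Ideal.span {h})
  have hπ (f : MvPolynomial (Fin 2) K) : aeval (fun i => π (X i)) f = 0 ↔ h ∣ f := by
    rw [← Ideal.mem_span_singleton, ← Ideal.Quotient.eq_zero_iff_mem]
    exact (DFunLike.congr_fun (aeval_unique π) f).symm.congr_left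
  have : CharP (MvPolynomial (Fin 2) K ⧸ Ideal.span {h}) (2 * n + 1) :=
    charP_of_injective_algebraMap (algebraMap K _).injective _
  have hzero := eq_zero_of_aeval_cubicDisc_of_aeval_hasseCoeff hn ((hπ _).mpr hdisc) ((hπ _).mpr hc)
  have hdvd (i : Fin 2) : h ∣ X i := (hπ _).mp ((aeval_X _ i).trans (congrFun hzero i))
  have hX := (hh.irreducible.dvd_symm X_prime.irreducible (hdvd 0)).trans (hdvd 1)
  exact zero_ne_one (X_dvd_X.mp hX)

variable {R : Type*} [CommRing R] [IsDomain R] [CharP R (2 * n + 1)]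
  {h u : MvPolynomial (Fin 2) R} {m : ℕ}

theorem dvd_serreDerivation_of_hasseCoeff_eq_pow_mul (hh : Prime h) (hm : m + 2 ≤ n)
    (hu : ¬ h ∣ u) (hc : hasseCoeff R n = h ^ (m + 2) * u) : h ∣ serreDerivation R h := by
  refine dvd_derivation_of_pow_dvd_derivation_derivation hh hu
    (not_dvd_natCast_of_lt (2 * n + 1) hh m.succ_pos (by omega))
    (not_dvd_natCast_of_lt (2 * n + 1) hh (m + 1).succ_pos (by omega)) ?_
  have h4 : IsUnit ((4 : ℕ) : MvPolynomial (Fin 2) R) :=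
    isUnit_natCast_of_lt _ (2 * n + 1) (by omega) (by omega)
  rw [← hc, ← h4.dvd_mul_left, Nat.cast_ofNat,
    four_mul_serreDerivation_serreDerivation_hasseCoeff (by omega) (CharP.cast_eq_zero R _), hc]
  exact (dvd_mul_right _ _).mul_left _

theorem dvd_eulerDerivation_of_hasseCoeff_eq_pow_mul (hh : Prime h) (hm : m + 1 ≤ n)
    (hu : ¬ h ∣ u) (hc : hasseCoeff R n = h ^ (m + 1) * u) : h ∣ eulerDerivation R h := by
  refine dvd_derivation_of_pow_dvd_derivation hh hu
    (not_dvd_natCast_of_lt (2 * n + 1) hh m.succ_pos (by omega)) ?_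
  rw [← hc, eulerDerivation_of_isWeightedHomogeneous (isWeightedHomogeneous_hasseCoeff R n), hc]
  exact dvd_smul_of_dvd n (dvd_mul_right _ _)

theorem squarefree_hasseCoeff (K : Type*) [Field K] [CharP K (2 * n + 1)] (hn : 2 ≤ n) :
    Squarefree (hasseCoeff K n) := by
  have hc0 : hasseCoeff K n ≠ 0 := hasseCoeff_ne_zero K hn
  rw [squarefree_iff_irreducible_sq_not_dvd_of_ne_zero hc0]
  intro h hirr hsq
  have hh := hirr.prime
  obtain ⟨m, u, hc, hu⟩ := exists_eq_pow_add_two_mul_and_not_dvd hh hc0 hsq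
  have hpow : h ^ (m + 2) ∣ hasseCoeff K n := hc ▸ dvd_mul_right _ _
  have hpos := totalDegree_pos_of_prime hh
  have hdeg : (m + 2) * h.totalDegree ≤ n := by
    refine (mul_totalDegree_le_of_pow_dvd hc0 hpow).trans ?_
    refine totalDegree_le_of_isWeightedHomogeneous (fun i => ?_)
      (isWeightedHomogeneous_hasseCoeff K n)
    fin_cases i <;> simp
  have hm : m + 2 ≤ n := (Nat.le_mul_of_pos_right _ hpos).trans hdeg
  have hlt : h.totalDegree < 2 * n + 1 := by
    have := (Nat.le_mul_of_pos_left h.totalDegree (Nat.succ_pos (m + 1))).trans hdeg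
    omega
  exact not_dvd_cubicDisc_of_dvd_hasseCoeff hn hh ((dvd_pow_self h (by omega)).trans hpow)
    (dvd_cubicDisc_of_dvd_derivations (2 * n + 1) hh
      (dvd_serreDerivation_of_hasseCoeff_eq_pow_mul hh hm hu hc)
      (dvd_eulerDerivation_of_hasseCoeff_eq_pow_mul hh hm hu hc) hpos hlt)

end Squarefree

theorem mainTheorem8_general (p : ℕ) [Fact p.Prime] (hp : 5 ≤ p) (K : Type*) [Field K]
    [Algebra (ZMod p) K] :
    IsWeightedHomogeneous (![2, 3] : Fin 2 → ℕ) (cAB p) ((p - 1) / 2) ∧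
    cAB p ≠ 0 ∧
    Squarefree (map (algebraMap (ZMod p) K) (cAB p)) ∧
    ∀ γ : K, γ ≠ 0 → Irreducible (map (algebraMap (ZMod p) K) (cAB p) - C γ) := by
  obtain ⟨n, rfl⟩ : Odd p := (Fact.out : p.Prime).odd_of_ne_two (by omega)
  have hn : 2 ≤ n := by omega
  have : CharP K (2 * n + 1) :=
    charP_of_injective_algebraMap (algebraMap (ZMod (2 * n + 1)) K).injective _
  rw [cAB_two_mul_add_one, map_hasseCoeff, Nat.add_sub_cancel, Nat.mul_div_cancel_left n two_pos]
  exact ⟨isWeightedHomogeneous_hasseCoeff _ n, hasseCoeff_ne_zero _ hn, squarefree_hasseCoeff K hn,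
    fun γ hγ => irreducible_sub_C_of_isWeightedHomogeneous (isWeightedHomogeneous_hasseCoeff K n)
      (by omega) (squarefree_hasseCoeff K hn) hγ.isUnit⟩

theorem mainTheorem8 (p : ℕ) [Fact p.Prime] (hp : 5 ≤ p) :
    MvPolynomial.IsWeightedHomogeneous (![2, 3] : Fin 2 → ℕ) (cAB p) ((p - 1) / 2) ∧
    cAB p ≠ 0 ∧
    AbsolutelySquarefree (cAB p) ∧
    ∀ γ : AlgebraicClosure (ZMod p), γ ≠ 0 →
      Irreducible
        (MvPolynomial.map (algebraMap (ZMod p) (AlgebraicClosure (ZMod p))) (cAB p)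
          - MvPolynomial.C γ) :=
  mainTheorem8_general p hp (AlgebraicClosure (ZMod p))
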